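/- For a positive integer $n$, let $\|n\|$ denote its integer complexity, the least number of $1$'s needed to write $n$ using any combination of additions and multiplications. For $k\ge 1$ let $E(k)$ be the largest $n$ with $\|n\|\le k$, and for $r\ge 0$ let $E_r(k)$ be the $r$-th largest number of complexity at most $k$, counting from $0$ (so $E_0(k)=E(k)$). For $r\ge 0$ and a residue class $a$ modulo $3$, define $h_{r,a}\in\mathbb{Q}$ and $K_{r,a}\in\mathbb{N}$ by the following tables. For $a=0$: \[ \begin{array}{r|r|r} r & h_{r,0} & K_{r,0}\\ \hline 0 & 1 & 3\\ 1 & 8/9 & 6\\ 2 & 64/81 & 12\\ 3 & 7/9 & 12\\ 4 & 20/27 & 12\\ 5 & 19/27 & 12\\ 6 & 512/729 & 18\\ 7 & 56/81 & 18\\ 8 & 55/81 & 18\\ 9 & 164/243 & 18\\ 10 & 163/243 & 18\\ 2n-1\ (n\ge 6) & 2/3+2/3^n & 3n\\ 2n\ (n\ge 6) & 2/3+1/3^n & 3n \end{array} \] For $a=2$: \[ \begin{array}{r|r|r} r & h_{r,2} & K_{r,2}\\ \hline 0 & 1 & 2\\ 1 & 8/9 & 8\\ 2 & 5/6 & 8\\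 3 & 64/81 & 14\\ 4 & 7/9 & 14\\ 5 & 20/27 & 14\\ 6 & 13/18 & 14\\ 7 & 19/27 & 14\\ 8 & 512/729 & 20\\ 9 & 56/81 & 20\\ 10 & 37/54 & 20\\ 11 & 55/81 & 20\\ 12 & 164/243 & 20\\ 13 & 109/162 & 20\\ 14 & 163/243 & 20\\ 3n-3\ (n\ge 6) & 2/3+2/3^n & 3n+2\\ 3n-2\ (n\ge 6) & 2/3+1/(2\cdot 3^{n-1}) & 3n+2\\ 3n-1\ (n\ge 6) & 2/3+1/3^n & 3n+2 \end{array} \] For $a=1$: \[ \begin{array}{r|r|r} r & h_{r,1} & K_{r,1}\\ \hline 0 & 1 & 4\\ 1 & 8/9 & 10\\ 2 & 5/6 & 10\\ 3 & 64/81 & 16\\ 4 & 7/9 & 16\\ 5 & 41/54 & 16\\ n+2\ (n\ge 4) & 3/4+1/(4\cdot 3^n) & 3n+4 \end{array} \] Then for every $r\ge 0$ and every residue class $a$ modulo $3$ we have $K_{r,a}>1$, and for every $k\ge K_{r,a}$ with $k\equiv a\pmod 3$, the number $E_r(k)$ exists and \[ E_r(k)=h_{r,a}\,E(k). \] Moreover,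 for such $r$ and $k$ we have $E_r(k)>E(k-1)$ and $\|E_r(k)\|=k$; thus $E_r(k)$ is not only the $r$-th largest number of complexity at most $k$, but also the $r$-th largest number (counting from $0$) of complexity exactly $k$. -/

import Mathlib

namespace IntegerComplexity

/-- Arithmetic expressions built from the number `1` by addition and multiplication. -/
inductive OnesExpr : Type
  | one : OnesExpr
  | add : OnesExpr → OnesExpr → OnesExpr
  | mul : OnesExpr → OnesExpr → OnesExpr

/-- The value of an expression. -/
def OnesExpr.eval : OnesExpr → ℕ
  | .one => 1
  | .add e f => e.eval + f.eval
  | .mul e f => e.eval * f.eval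

/-- The number of ones occurring in an expression. -/
def OnesExpr.ones : OnesExpr → ℕ
  | .one => 1
  | .add e f => e.ones + f.ones
  | .mul e f => e.ones + f.ones

/-- Every positive integer is the value of some expression. -/
theorem OnesExpr.exists_eval_eq (n : ℕ) (hn : 0 < n) : ∃ e : OnesExpr, e.eval = n := by
  induction n, hn using Nat.le_induction with
  | base => exact ⟨.one, rfl⟩
  | succ n _ ih =>
    obtain ⟨e, he⟩ := ih
    exact ⟨.add e .one, by simp [OnesExpr.eval, he]⟩

/-- The integer complexity of `n ≥ 1`: the least number of ones needed to write `n` using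
additions and multiplications. (The value at `0` is meaningless and never used.) -/
noncomputable def cpx (n : ℕ) : ℕ :=
  sInf {c | ∃ e : OnesExpr, e.eval = n ∧ e.ones = c}

/-- The positive integers of complexity at most `k`. -/
def cpxLE (k : ℕ) : Set ℕ := {n | 0 < n ∧ cpx n ≤ k}

/-- The positive integers of complexity exactly `k`. -/
def cpxEq (k : ℕ) : Set ℕ := {n | 0 < n ∧ cpx n = k}

/-- `n` is the `r`-th largest element of `S`, counting from `0`: it lies in `S`, and exactly `r`
elements of `S` exceed it. -/
def IsRthLargest (S : Set ℕ) (r n : ℕ) : Prop :=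
  n ∈ S ∧ {m ∈ S | n < m}.encard = r

/-- `E(k)`: the largest number of complexity at most `k`. -/
noncomputable def E (k : ℕ) : ℕ := sSup (cpxLE k)

/-- `E_r(k)`: the `r`-th largest number (counting from `0`) of complexity at most `k`; the value
is `0` if there is no such number. -/
noncomputable def Er (r k : ℕ) : ℕ := sSup {n | IsRthLargest (cpxLE k) r n}

/-- An expression with `c` ones has `c ≥ 1` and value at most `2 ^ c`. -/
theorem OnesExpr.one_le_ones_and_eval_le (e : OnesExpr) : 1 ≤ e.ones ∧ e.eval ≤ 2 ^ e.ones := by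
  induction e with
  | one => simp [OnesExpr.eval, OnesExpr.ones]
  | add e f he hf =>
    obtain ⟨he1, he2⟩ := he
    obtain ⟨hf1, hf2⟩ := hf
    refine ⟨by simp only [OnesExpr.ones]; omega, ?_⟩
    have h1 : 2 ≤ 2 ^ e.ones := Nat.le_self_pow (by omega) 2
    have h2 : 2 ≤ 2 ^ f.ones := Nat.le_self_pow (by omega) 2
    simp only [OnesExpr.eval, OnesExpr.ones, pow_add]
    nlinarith
  | mul e f he hf =>
    refine ⟨by simp only [OnesExpr.ones]; omega, ?_⟩
    simp only [OnesExpr.eval, OnesExpr.ones, pow_add]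
    exact Nat.mul_le_mul he.2 hf.2

/-- For `k ≥ 1` the number `E k` really is the largest number of complexity at most `k`. -/
theorem isGreatest_E (k : ℕ) (hk : 1 ≤ k) : IsGreatest (cpxLE k) (E k) := by
  have hb : BddAbove (cpxLE k) := by
    refine ⟨2 ^ k, ?_⟩
    rintro n ⟨hn, hc⟩
    obtain ⟨e, he⟩ := OnesExpr.exists_eval_eq n hn
    obtain ⟨f, hf, hfc⟩ : cpx n ∈ {c | ∃ e : OnesExpr, e.eval = n ∧ e.ones = c} :=
      Nat.sInf_mem ⟨_, e, he, rfl⟩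
    calc n ≤ 2 ^ f.ones := hf ▸ f.one_le_ones_and_eval_le.2
      _ ≤ 2 ^ k := Nat.pow_le_pow_right (by norm_num) (hfc ▸ hc)
  have hne : (cpxLE k).Nonempty :=
    ⟨1, Nat.one_pos, (Nat.sInf_le ⟨OnesExpr.one, rfl, rfl⟩ : cpx 1 ≤ 1).trans hk⟩
  exact ⟨Nat.sSup_mem hne hb, fun _ hn => le_csSup hb hn⟩

/-- The `r`-th largest element is unique, so `E_r(k)` is that element whenever it exists. -/
theorem IsRthLargest.unique {S : Set ℕ} {r m n : ℕ}
    (hm : IsRthLargest S r m) (hn : IsRthLargest S r n) : m = n := by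
  have key : ∀ a b : ℕ, IsRthLargest S r a → IsRthLargest S r b → ¬ a < b := by
    intro a b ha hb hab
    have hfin : {x ∈ S | b < x}.Finite :=
      Set.finite_of_encard_le_coe (k := r) hb.2.le
    have hss : {x ∈ S | b < x} ⊂ {x ∈ S | a < x} :=
      ⟨fun x hx => ⟨hx.1, hab.trans hx.2⟩, fun h => lt_irrefl b (h ⟨hb.1, hab⟩).2⟩
    have := hfin.encard_lt_encard hss
    rw [ha.2, hb.2] at this
    exact lt_irrefl _ this
  have h1 := key m n hm hn
  have h2 := key n m hn hm
  omega

/-- If the `r`-th largest number of complexity at most `k` exists, it is `Er r k`. -/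
theorem IsRthLargest.Er_eq {r k n : ℕ} (h : IsRthLargest (cpxLE k) r n) : Er r k = n := by
  have : {m | IsRthLargest (cpxLE k) r m} = {n} :=
    Set.eq_singleton_iff_unique_mem.2 ⟨h, fun _ hm => IsRthLargest.unique hm h⟩
  rw [Er, this, csSup_singleton]

/-- The coefficients for `k ≡ 0 (mod 3)`. From `r = 11` on they are `2/3 + 2/3^n` for `r = 2n - 1`
and `2/3 + 1/3^n` for `r = 2n`. -/
def h₀ : ℕ → ℚ
  | 0 => 1
  | 1 => 8 / 9
  | 2 => 64 / 81
  | 3 => 7 / 9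
  | 4 => 20 / 27
  | 5 => 19 / 27
  | 6 => 512 / 729
  | 7 => 56 / 81
  | 8 => 55 / 81
  | 9 => 164 / 243
  | 10 => 163 / 243
  | r => if r % 2 = 1 then 2 / 3 + 2 / 3 ^ ((r + 1) / 2) else 2 / 3 + 1 / 3 ^ (r / 2)

/-- The thresholds for `k ≡ 0 (mod 3)`. From `r = 11` on they are `3n` for `r = 2n - 1` and for
`r = 2n`. -/
def K₀ : ℕ → ℕ
  | 0 => 3
  | 1 => 6
  | 2 => 12
  | 3 => 12
  | 4 => 12
  | 5 => 12
  | 6 => 18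
  | 7 => 18
  | 8 => 18
  | 9 => 18
  | 10 => 18
  | r => 3 * ((r + 1) / 2)

/-- The coefficients for `k ≡ 2 (mod 3)`. From `r = 15` on they are `2/3 + 2/3^n` for `r = 3n - 3`,
`2/3 + 1/(2 * 3^(n-1))` for `r = 3n - 2`, and `2/3 + 1/3^n` for `r = 3n - 1`; thus
`n = r / 3 + 1`, rounding down. -/
def h₂ : ℕ → ℚ
  | 0 => 1
  | 1 => 8 / 9
  | 2 => 5 / 6
  | 3 => 64 / 81
  | 4 => 7 / 9
  | 5 => 20 / 27
  | 6 => 13 / 18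
  | 7 => 19 / 27
  | 8 => 512 / 729
  | 9 => 56 / 81
  | 10 => 37 / 54
  | 11 => 55 / 81
  | 12 => 164 / 243
  | 13 => 109 / 162
  | 14 => 163 / 243
  | r =>
    if r % 3 = 0 then 2 / 3 + 2 / 3 ^ (r / 3 + 1)
    else if r % 3 = 1 then 2 / 3 + 1 / (2 * 3 ^ (r / 3))
    else 2 / 3 + 1 / 3 ^ (r / 3 + 1)

/-- The thresholds for `k ≡ 2 (mod 3)`. From `r = 15` on they are `3n + 2` for
`r = 3n - 3`, `r = 3n - 2` and `r = 3n - 1`. -/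
def K₂ : ℕ → ℕ
  | 0 => 2
  | 1 => 8
  | 2 => 8
  | 3 => 14
  | 4 => 14
  | 5 => 14
  | 6 => 14
  | 7 => 14
  | 8 => 20
  | 9 => 20
  | 10 => 20
  | 11 => 20
  | 12 => 20
  | 13 => 20
  | 14 => 20
  | r => 3 * (r / 3 + 1) + 2

/-- The coefficients for `k ≡ 1 (mod 3)`. From `r = 6` on they are `3/4 + 1/(4 * 3^n)` for
`r = n + 2`. -/
def h₁ : ℕ → ℚ
  | 0 => 1
  | 1 => 8 / 9
  | 2 => 5 / 6
  | 3 => 64 / 81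
  | 4 => 7 / 9
  | 5 => 41 / 54
  | r => 3 / 4 + 1 / (4 * 3 ^ (r - 2))

/-- The thresholds for `k ≡ 1 (mod 3)`. From `r = 6` on they are `3n + 4` for `r = n + 2`. -/
def K₁ : ℕ → ℕ
  | 0 => 4
  | 1 => 10
  | 2 => 10
  | 3 => 16
  | 4 => 16
  | 5 => 16
  | r => 3 * (r - 2) + 4

/-- The coefficient `h_{r,a}`. -/
def h (r : ℕ) (a : ZMod 3) : ℚ :=
  if a = 0 then h₀ r else if a = 1 then h₁ r else h₂ r

/-- The threshold `K_{r,a}`. -/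
def K (r : ℕ) (a : ZMod 3) : ℕ :=
  if a = 0 then K₀ r else if a = 1 then K₁ r else K₂ r

end IntegerComplexity

namespace IntegerComplexity

/-! ### Basic bounds for the complexity -/

/-! The proof describes the numbers of complexity at most `k` that exceed `E (k - 1)` by their ratio
to `E k`. For `k ≥ 2`, `E k` is `3 * 3^m`, `2 * 3^m` or `4 * 3^m`, so `E (k - 1) / E k` is `2/3` for
`k ≡ 0, 2` and `3/4` for `k ≡ 1 (mod 3)`, except that it is `1/2` at `k = 2`.

Look at the last operation in an expression for such a number. Because `E` is convex, a sum with `k`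
ones is at most `E (k - 1) + 1`, so it must equal that value. In a product, each factor must itself
exceed the `E`-bound of one less (`topSet_cases`). Hence all ratios arise from those of `E (k - 1) +
1` by multiplication, with a correction `E i * E j / E (i + j)`, which is `1` or `8/9`. The tables
are closed under these products as long as the result stays above `2/3` or `3/4`. Only finitely many
nontrivial products do, so this is a finite check, and `eq_coeff_mul_of_mem_topSet` follows by
strong induction.

Conversely, each coefficient is attained at its threshold by an explicit number, and multiplication
by `3` carries it to all larger `k` in the class (`exists_h`). The coefficients decrease and the
thresholds increase in `r`, so the numbers above the `r`-th value are exactly those of index below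
`r`. -/

theorem exists_expr {n : ℕ} (hn : 0 < n) : ∃ e : OnesExpr, e.eval = n ∧ e.ones = cpx n := by
  obtain ⟨e, he⟩ := OnesExpr.exists_eval_eq n hn
  exact Nat.sInf_mem (s := {c | ∃ e : OnesExpr, e.eval = n ∧ e.ones = c}) ⟨_, e, he, rfl⟩

theorem cpx_eval_le (e : OnesExpr) : cpx e.eval ≤ e.ones := Nat.sInf_le ⟨e, rfl, rfl⟩

theorem OnesExpr.eval_pos (e : OnesExpr) : 0 < e.eval := by
  induction e with
  | one => simp [OnesExpr.eval]
  | add e f he hf => simp only [OnesExpr.eval]; omega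
  | mul e f he hf => exact Nat.mul_pos he hf

theorem mem_cpxLE_iff {n k : ℕ} : n ∈ cpxLE k ↔ ∃ e : OnesExpr, e.eval = n ∧ e.ones ≤ k := by
  constructor
  · rintro ⟨hn, hk⟩
    obtain ⟨e, he, hc⟩ := exists_expr hn
    exact ⟨e, he, hc ▸ hk⟩
  · rintro ⟨e, rfl, hk⟩
    exact ⟨e.eval_pos, (cpx_eval_le e).trans hk⟩

theorem one_mem_cpxLE : 1 ∈ cpxLE 1 := mem_cpxLE_iff.2 ⟨.one, rfl, le_rfl⟩

theorem add_mem_cpxLE {a b i j : ℕ} (ha : a ∈ cpxLE i) (hb : b ∈ cpxLE j) :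
    a + b ∈ cpxLE (i + j) := by
  obtain ⟨e, rfl, he⟩ := mem_cpxLE_iff.1 ha
  obtain ⟨f, rfl, hf⟩ := mem_cpxLE_iff.1 hb
  exact mem_cpxLE_iff.2 ⟨.add e f, rfl, Nat.add_le_add he hf⟩

theorem mul_mem_cpxLE {a b i j : ℕ} (ha : a ∈ cpxLE i) (hb : b ∈ cpxLE j) :
    a * b ∈ cpxLE (i + j) := by
  obtain ⟨e, rfl, he⟩ := mem_cpxLE_iff.1 ha
  obtain ⟨f, rfl, hf⟩ := mem_cpxLE_iff.1 hb
  exact mem_cpxLE_iff.2 ⟨.mul e f, rfl, Nat.add_le_add he hf⟩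

theorem two_mem_cpxLE : 2 ∈ cpxLE 2 := add_mem_cpxLE one_mem_cpxLE one_mem_cpxLE

theorem three_mem_cpxLE : 3 ∈ cpxLE 3 := add_mem_cpxLE two_mem_cpxLE one_mem_cpxLE

theorem mul_three_pow_mem_cpxLE {n k : ℕ} (hn : n ∈ cpxLE k) (j : ℕ) :
    n * 3 ^ j ∈ cpxLE (k + 3 * j) := by
  induction j with
  | zero => simpa using hn
  | succ j ih =>
    have := mul_mem_cpxLE ih three_mem_cpxLE
    rwa [mul_assoc, ← pow_succ, add_assoc, ← mul_add_one] at this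

/-! ### The largest number of given complexity -/

/-- The closed form of `E`. -/
def maxVal : ℕ → ℕ
  | 0 => 0
  | 1 => 1
  | 2 => 2
  | 3 => 3
  | 4 => 4
  | k + 5 => 3 * maxVal (k + 2)

theorem maxVal_add_three {k : ℕ} (hk : 2 ≤ k) : maxVal (k + 3) = 3 * maxVal k := by
  obtain ⟨k, rfl⟩ := Nat.exists_eq_add_of_le' hk
  rfl

theorem maxVal_add_three_mul {k : ℕ} (hk : 2 ≤ k) (j : ℕ) :
    maxVal (k + 3 * j) = maxVal k * 3 ^ j := by
  induction j with
  | zero => simp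
  | succ j ih =>
    rw [mul_add_one, ← add_assoc, maxVal_add_three (by omega), ih]
    ring

theorem maxVal_three (m : ℕ) : maxVal (3 * m + 3) = 3 * 3 ^ m := by
  rw [add_comm, maxVal_add_three_mul (by omega)]; rfl

theorem maxVal_two (m : ℕ) : maxVal (3 * m + 2) = 2 * 3 ^ m := by
  rw [add_comm, maxVal_add_three_mul (by omega)]; rfl

theorem maxVal_four (m : ℕ) : maxVal (3 * m + 4) = 4 * 3 ^ m := by
  rw [add_comm, maxVal_add_three_mul (by omega)]; rfl

theorem two_le_cases {k : ℕ} (hk : 2 ≤ k) :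
    (∃ m, k = 3 * m + 3) ∨ (∃ m, k = 3 * m + 2) ∨ ∃ m, k = 3 * m + 4 := by
  have : k % 3 = 0 ∨ k % 3 = 1 ∨ k % 3 = 2 := by omega
  rcases this with h | h | h
  · exact .inl ⟨(k - 3) / 3, by omega⟩
  · exact .inr (.inr ⟨(k - 4) / 3, by omega⟩)
  · exact .inr (.inl ⟨(k - 2) / 3, by omega⟩)

theorem maxVal_lt_succ : ∀ k, maxVal k < maxVal (k + 1)
  | 0 | 1 | 2 | 3 | 4 => by decide
  | k + 5 => by
    have := maxVal_lt_succ (k + 2)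
    rw [show maxVal (k + 5) = 3 * maxVal (k + 2) from rfl,
      show maxVal (k + 5 + 1) = 3 * maxVal (k + 2 + 1) from rfl]
    omega

theorem maxVal_strictMono : StrictMono maxVal := strictMono_nat_of_lt_succ maxVal_lt_succ

theorem maxVal_pos {k : ℕ} (hk : 0 < k) : 0 < maxVal k := maxVal_strictMono hk

theorem maxVal_convex : ∀ k, 2 * maxVal (k + 1) ≤ maxVal k + maxVal (k + 2)
  | 0 | 1 | 2 | 3 | 4 => by decide
  | k + 5 => by
    have := maxVal_convex (k + 2)
    rw [show maxVal (k + 5) = 3 * maxVal (k + 2) from rfl,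
      show maxVal (k + 5 + 1) = 3 * maxVal (k + 2 + 1) from rfl,
      show maxVal (k + 5 + 2) = 3 * maxVal (k + 2 + 2) from rfl]
    omega

/-- Telescoped convexity: increments of `maxVal` do not decrease. -/
theorem maxVal_succ_add_le (k d : ℕ) :
    maxVal (k + 1) + maxVal (k + d) ≤ maxVal k + maxVal (k + d + 1) := by
  induction d with
  | zero => simp [add_comm]
  | succ d ih =>
    have := maxVal_convex (k + d)
    rw [← add_assoc]
    rw [add_assoc (k + d) 1 1, one_add_one_eq_two]
    omega

/-- By convexity, two summands with a fixed total of ones do best when one of them is a single `1`.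
The total here is `i + j + 2`, so a sum beats the best value with one fewer `1` by at most one. -/
theorem maxVal_add_le (i j : ℕ) :
    maxVal (i + 1) + maxVal (j + 1) ≤ maxVal (i + j + 1) + 1 := by
  induction j with
  | zero => simp [maxVal]
  | succ j ih =>
    have := maxVal_succ_add_le (j + 1) i
    rw [show j + 1 + i = i + j + 1 by ring] at this
    rw [← add_assoc]
    omega

theorem maxVal_mul_le : ∀ i j, maxVal i * maxVal j ≤ maxVal (i + j) := by
  have base : ∀ i j, i ≤ 1 → maxVal i * maxVal j ≤ maxVal (i + j) := by
    intro i j hi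
    have := maxVal_strictMono.monotone (Nat.le_add_left j i)
    interval_cases i
    · simp [maxVal]
    · simp only [maxVal, one_mul]; omega
  intro i j
  rcases le_or_gt i 1 with hi | hi
  · exact base i j hi
  rcases le_or_gt j 1 with hj | hj
  · rw [mul_comm, add_comm]; exact base j i hj
  -- The product equals `maxVal (i + j)` if a residue is `0` or both are `2`; otherwise it is `8/9`
  -- of it (`8` against `9`, or `16` against `18`).
  rcases two_le_cases hi with ⟨m, rfl⟩ | ⟨m, rfl⟩ | ⟨m, rfl⟩ <;>
  rcases two_le_cases hj with ⟨l, rfl⟩ | ⟨l, rfl⟩ | ⟨l, rfl⟩ <;> [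
    rw [show 3 * m + 3 + (3 * l + 3) = 3 * (m + l + 1) + 3 by ring];
    rw [show 3 * m + 3 + (3 * l + 2) = 3 * (m + l + 1) + 2 by ring];
    rw [show 3 * m + 3 + (3 * l + 4) = 3 * (m + l + 1) + 4 by ring];
    rw [show 3 * m + 2 + (3 * l + 3) = 3 * (m + l + 1) + 2 by ring];
    rw [show 3 * m + 2 + (3 * l + 2) = 3 * (m + l) + 4 by ring];
    rw [show 3 * m + 2 + (3 * l + 4) = 3 * (m + l + 1) + 3 by ring];
    rw [show 3 * m + 4 + (3 * l + 3) = 3 * (m + l + 1) + 4 by ring];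
    rw [show 3 * m + 4 + (3 * l + 2) = 3 * (m + l + 1) + 3 by ring];
    rw [show 3 * m + 4 + (3 * l + 4) = 3 * (m + l + 2) + 2 by ring]] <;>
  simp only [maxVal_two, maxVal_three, maxVal_four, pow_add] <;>
  nlinarith [Nat.zero_le (3 ^ m * 3 ^ l)]

theorem maxVal_mem_cpxLE {k : ℕ} (hk : 1 ≤ k) : maxVal k ∈ cpxLE k := by
  rcases hk.eq_or_lt with rfl | hk
  · exact one_mem_cpxLE
  rcases two_le_cases hk with ⟨m, rfl⟩ | ⟨m, rfl⟩ | ⟨m, rfl⟩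
  · rw [maxVal_three, add_comm]; exact mul_three_pow_mem_cpxLE three_mem_cpxLE m
  · rw [maxVal_two, add_comm]; exact mul_three_pow_mem_cpxLE two_mem_cpxLE m
  · rw [maxVal_four, add_comm]
    exact mul_three_pow_mem_cpxLE (mul_mem_cpxLE two_mem_cpxLE two_mem_cpxLE) m

theorem OnesExpr.eval_le_maxVal (e : OnesExpr) : e.eval ≤ maxVal e.ones := by
  induction e with
  | one => exact le_rfl
  | add e f he hf =>
    have h1 := e.one_le_ones_and_eval_le.1
    have h2 := f.one_le_ones_and_eval_le.1
    simp only [OnesExpr.eval, OnesExpr.ones]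
    obtain ⟨i, hi⟩ := Nat.exists_eq_add_of_le' h1
    obtain ⟨j, hj⟩ := Nat.exists_eq_add_of_le' h2
    have := maxVal_add_le i j
    have := maxVal_lt_succ (i + j + 1)
    rw [hi] at he
    rw [hj] at hf
    rw [hi, hj, show i + 1 + (j + 1) = i + j + 1 + 1 by ring]
    omega
  | mul e f he hf => exact (Nat.mul_le_mul he hf).trans (maxVal_mul_le _ _)

theorem le_maxVal_of_mem_cpxLE {n k : ℕ} (h : n ∈ cpxLE k) : n ≤ maxVal k := by
  obtain ⟨e, rfl, he⟩ := mem_cpxLE_iff.1 h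
  exact e.eval_le_maxVal.trans (maxVal_strictMono.monotone he)

theorem E_eq_maxVal {k : ℕ} (hk : 1 ≤ k) : E k = maxVal k :=
  (isGreatest_E k hk).unique ⟨maxVal_mem_cpxLE hk, fun _ h => le_maxVal_of_mem_cpxLE h⟩

/-! ### Numbers of complexity at most `k` that exceed `E (k - 1)` -/

/-- The numbers of complexity at most `k` exceeding every number of complexity at most `k - 1`. -/
def topSet (k : ℕ) : Set ℕ := {n ∈ cpxLE k | maxVal (k - 1) < n}

/-- If `a` were at most `maxVal (i - 1)`, supermultiplicativity would push `a * b` down to `maxVal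
(i + j - 1)`. For `i = 1` this uses `maxVal 0 = 0`. -/
theorem mem_topSet_of_mul {a b i j : ℕ} (ha : a ∈ cpxLE i) (hb : b ∈ cpxLE j) (hi : 1 ≤ i)
    (hab : maxVal (i + j - 1) < a * b) : a ∈ topSet i := by
  refine ⟨ha, lt_of_not_ge fun h => hab.not_ge ?_⟩
  calc a * b ≤ maxVal (i - 1) * maxVal j := Nat.mul_le_mul h (le_maxVal_of_mem_cpxLE hb)
    _ ≤ maxVal (i - 1 + j) := maxVal_mul_le _ _
    _ = maxVal (i + j - 1) := by rw [Nat.sub_add_comm hi]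

/-- The alternatives are the two possible last operations. A sum is squeezed between `maxVal (k -
1)` and the bound of `maxVal_add_le`. -/
theorem topSet_cases {n k : ℕ} (hn : n ∈ topSet k) (hk : 2 ≤ k) :
    n = maxVal (k - 1) + 1 ∨ ∃ i j a b, 2 ≤ i ∧ 2 ≤ j ∧ i + j = k ∧ a ∈ topSet i ∧
      b ∈ topSet j ∧ n = a * b := by
  obtain ⟨hn, hlt⟩ := hn
  obtain ⟨e, rfl, he⟩ := mem_cpxLE_iff.1 hn
  have hek : e.ones = k := by
    refine le_antisymm he (le_of_not_gt fun h => ?_)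
    have := e.eval_le_maxVal.trans
      (maxVal_strictMono.monotone (show e.ones ≤ k - 1 by omega))
    omega
  subst hek
  cases e with
  | one => simp [OnesExpr.ones] at hk
  | add e f =>
    left
    simp only [OnesExpr.eval, OnesExpr.ones] at *
    have h1 := e.eval_le_maxVal
    have h2 := f.eval_le_maxVal
    obtain ⟨i, hi⟩ := Nat.exists_eq_add_of_le' e.one_le_ones_and_eval_le.1
    obtain ⟨j, hj⟩ := Nat.exists_eq_add_of_le' f.one_le_ones_and_eval_le.1
    have := maxVal_add_le i j
    rw [hi, hj, show i + 1 + (j + 1) - 1 = i + j + 1 by omega] at hlt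
    rw [hi] at h1
    rw [hj] at h2
    rw [hi, hj, show i + 1 + (j + 1) - 1 = i + j + 1 by omega]
    omega
  | mul e f =>
    right
    simp only [OnesExpr.eval, OnesExpr.ones] at *
    have h1 := e.one_le_ones_and_eval_le.1
    have h2 := f.one_le_ones_and_eval_le.1
    have he' : e.eval ∈ cpxLE e.ones := mem_cpxLE_iff.2 ⟨e, rfl, le_rfl⟩
    have hf' : f.eval ∈ cpxLE f.ones := mem_cpxLE_iff.2 ⟨f, rfl, le_rfl⟩
    -- A factor using a single `1` equals `1`, so the other factor would exceed `maxVal (k - 1)`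
    -- with only `k - 1` ones.
    have ne_one : ∀ e f : OnesExpr, maxVal (e.ones + f.ones - 1) < e.eval * f.eval →
        e.ones ≠ 1 := by
      intro e f hlt h
      have h1 := e.eval_le_maxVal
      have h2 := f.eval_le_maxVal
      rw [h, Nat.add_sub_cancel_left] at hlt
      rw [h] at h1
      have := Nat.mul_le_mul h1 h2
      simp only [maxVal, one_mul] at this
      omega
    have hlt' : maxVal (f.ones + e.ones - 1) < f.eval * e.eval := by rwa [add_comm, mul_comm]
    have := ne_one e f hlt
    have := ne_one f e hlt'
    exact ⟨_, _, _, _, by omega, by omega, rfl, mem_topSet_of_mul he' hf' h1 hlt,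
      mem_topSet_of_mul hf' he' h2 hlt', rfl⟩

/-! ### The coefficients -/

theorem h₀_odd {n : ℕ} (hn : 6 ≤ n) : h₀ (2 * n - 1) = 2 / 3 + 2 / 3 ^ n := by
  obtain ⟨n, rfl⟩ := Nat.exists_eq_add_of_le' hn
  rw [show 2 * (n + 6) - 1 = 2 * n + 11 by omega]
  simp only [h₀]
  rw [if_pos (by omega), show (2 * n + 11 + 1) / 2 = n + 6 by omega]

theorem h₀_even {n : ℕ} (hn : 6 ≤ n) : h₀ (2 * n) = 2 / 3 + 1 / 3 ^ n := by
  obtain ⟨n, rfl⟩ := Nat.exists_eq_add_of_le' hn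
  rw [show 2 * (n + 6) = 2 * n + 1 + 11 by omega]
  simp only [h₀]
  rw [if_neg (by omega), show (2 * n + 1 + 11) / 2 = n + 6 by omega]

theorem h₂_zero {n : ℕ} (hn : 6 ≤ n) : h₂ (3 * n - 3) = 2 / 3 + 2 / 3 ^ n := by
  obtain ⟨n, rfl⟩ := Nat.exists_eq_add_of_le' hn
  rw [show 3 * (n + 6) - 3 = 3 * n + 15 by omega]
  simp only [h₂]
  rw [if_pos (by omega), show (3 * n + 15) / 3 + 1 = n + 6 by omega]

theorem h₂_one {n : ℕ} (hn : 6 ≤ n) : h₂ (3 * n - 2) = 2 / 3 + 1 / (2 * 3 ^ (n - 1)) := by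
  obtain ⟨n, rfl⟩ := Nat.exists_eq_add_of_le' hn
  rw [show 3 * (n + 6) - 2 = 3 * n + 1 + 15 by omega]
  simp only [h₂]
  rw [if_neg (by omega), if_pos (by omega), show (3 * n + 1 + 15) / 3 = n + 6 - 1 by omega]

theorem h₂_two {n : ℕ} (hn : 6 ≤ n) : h₂ (3 * n - 1) = 2 / 3 + 1 / 3 ^ n := by
  obtain ⟨n, rfl⟩ := Nat.exists_eq_add_of_le' hn
  rw [show 3 * (n + 6) - 1 = 3 * n + 2 + 15 by omega]
  simp only [h₂]
  rw [if_neg (by omega), if_neg (by omega), show (3 * n + 2 + 15) / 3 + 1 = n + 6 by omega]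

theorem h₁_large {n : ℕ} (hn : 4 ≤ n) : h₁ (n + 2) = 3 / 4 + 1 / (4 * 3 ^ n) := by
  obtain ⟨n, rfl⟩ := Nat.exists_eq_add_of_le' hn
  rfl

theorem eleven_le_cases {r : ℕ} (hr : 11 ≤ r) : ∃ n, 6 ≤ n ∧ (r = 2 * n - 1 ∨ r = 2 * n) :=
  ⟨(r + 1) / 2, by omega, by omega⟩

theorem fifteen_le_cases {r : ℕ} (hr : 15 ≤ r) :
    ∃ n, 6 ≤ n ∧ (r = 3 * n - 3 ∨ r = 3 * n - 2 ∨ r = 3 * n - 1) :=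
  ⟨r / 3 + 1, by omega, by omega⟩

theorem h₀_strictAnti : StrictAnti h₀ := by
  refine strictAnti_nat_of_succ_lt fun r => ?_
  rcases lt_or_ge r 11 with hr | hr
  · interval_cases r <;> norm_num [h₀]
  · obtain ⟨n, hn, rfl | rfl⟩ := eleven_le_cases hr
    · rw [show 2 * n - 1 + 1 = 2 * n by omega, h₀_odd hn, h₀_even hn]
      gcongr; norm_num
    · rw [show 2 * n + 1 = 2 * (n + 1) - 1 by omega, h₀_odd (by omega), h₀_even hn, pow_succ]
      have : (0 : ℚ) < 1 / 3 ^ n := by positivity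
      rw [show (2 : ℚ) / (3 ^ n * 3) = 2 / 3 * (1 / 3 ^ n) by field_simp]
      linarith

theorem h₂_strictAnti : StrictAnti h₂ := by
  refine strictAnti_nat_of_succ_lt fun r => ?_
  rcases lt_or_ge r 15 with hr | hr
  · interval_cases r <;> norm_num [h₂]
  · obtain ⟨n, hn, hr⟩ := fifteen_le_cases hr
    have hp : (0 : ℚ) < 1 / 3 ^ n := by positivity
    -- In units of `1 / 3 ^ n`, the excesses over `2/3` within a block are `2`, `3/2`, `1`, and the
    -- next block starts at `2/3`.
    have e1 : (1 : ℚ) / (2 * 3 ^ (n - 1)) = 3 / 2 * (1 / 3 ^ n) := by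
      obtain ⟨n, rfl⟩ := Nat.exists_eq_add_of_le' hn
      rw [show n + 6 = n + 6 - 1 + 1 by omega, pow_succ, Nat.add_sub_cancel]
      field_simp
    have e2 : (2 : ℚ) / 3 ^ n = 2 * (1 / 3 ^ n) := by ring
    rcases hr with rfl | rfl | rfl
    · rw [show 3 * n - 3 + 1 = 3 * n - 2 by omega, h₂_zero hn, h₂_one hn, e1, e2]
      linarith
    · rw [show 3 * n - 2 + 1 = 3 * n - 1 by omega, h₂_two hn, h₂_one hn, e1]
      linarith
    · rw [show 3 * n - 1 + 1 = 3 * (n + 1) - 3 by omega, h₂_two hn, h₂_zero (by omega), pow_succ,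
        show (2 : ℚ) / (3 ^ n * 3) = 2 / 3 * (1 / 3 ^ n) by field_simp]
      linarith

theorem h₁_strictAnti : StrictAnti h₁ := by
  refine strictAnti_nat_of_succ_lt fun r => ?_
  rcases lt_or_ge r 6 with hr | hr
  · interval_cases r <;> norm_num [h₁]
  · obtain ⟨n, rfl⟩ : ∃ n, r = n + 2 := ⟨r - 2, by omega⟩
    rw [show n + 2 + 1 = n + 1 + 2 by ring, h₁_large (by omega), h₁_large (by omega)]
    gcongr <;> norm_num

theorem h₀_gt (r : ℕ) : 2 / 3 < h₀ r := by
  rcases lt_or_ge r 11 with hr | hr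
  · interval_cases r <;> norm_num [h₀]
  · obtain ⟨n, hn, rfl | rfl⟩ := eleven_le_cases hr
    · rw [h₀_odd hn]; exact lt_add_of_pos_right _ (by positivity)
    · rw [h₀_even hn]; exact lt_add_of_pos_right _ (by positivity)

theorem h₂_gt (r : ℕ) : 2 / 3 < h₂ r := by
  rcases lt_or_ge r 15 with hr | hr
  · interval_cases r <;> norm_num [h₂]
  · obtain ⟨n, hn, rfl | rfl | rfl⟩ := fifteen_le_cases hr
    · rw [h₂_zero hn]; exact lt_add_of_pos_right _ (by positivity)
    · rw [h₂_one hn]; exact lt_add_of_pos_right _ (by positivity)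
    · rw [h₂_two hn]; exact lt_add_of_pos_right _ (by positivity)

theorem h₁_gt (r : ℕ) : 3 / 4 < h₁ r := by
  rcases lt_or_ge r 6 with hr | hr
  · interval_cases r <;> norm_num [h₁]
  · obtain ⟨n, rfl⟩ : ∃ n, r = n + 2 := ⟨r - 2, by omega⟩
    rw [h₁_large (by omega)]; exact lt_add_of_pos_right _ (by positivity)

/-! ### Products of coefficients -/

/-- The cut is at `20/27` because `20/27 * 8/9 < 2/3`: a coefficient in the tail survives only
multiplication by `1`. The tail lies in the range of `h₂`, as needed when the other factor is the
coefficient `1` of that class. -/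
theorem range_h₀_cases {x : ℚ} (hx : x ∈ Set.range h₀) :
    x = 1 ∨ x = 8 / 9 ∨ x = 64 / 81 ∨ x = 7 / 9 ∨
      (0 < x ∧ x ≤ 20 / 27 ∧ x ∈ Set.range h₂) := by
  obtain ⟨r, rfl⟩ := hx
  rcases lt_or_ge r 4 with hr | hr
  · interval_cases r <;> simp [h₀]
  refine .inr (.inr (.inr (.inr ⟨by linarith [h₀_gt r], h₀_strictAnti.antitone hr, ?_⟩)))
  rcases lt_or_ge r 11 with hr' | hr'
  · interval_cases r
    exacts [⟨5, rfl⟩, ⟨7, rfl⟩, ⟨8, rfl⟩, ⟨9, rfl⟩, ⟨11, rfl⟩, ⟨12, rfl⟩, ⟨14, rfl⟩]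
  · obtain ⟨n, hn, rfl | rfl⟩ := eleven_le_cases hr'
    · exact ⟨3 * n - 3, by rw [h₀_odd hn, h₂_zero hn]⟩
    · exact ⟨3 * n - 1, by rw [h₀_even hn, h₂_two hn]⟩

theorem range_h₂_cases {x : ℚ} (hx : x ∈ Set.range h₂) :
    x = 1 ∨ x = 8 / 9 ∨ x = 5 / 6 ∨ x = 64 / 81 ∨ x = 7 / 9 ∨ (0 < x ∧ x ≤ 20 / 27) := by
  obtain ⟨r, rfl⟩ := hx
  rcases lt_or_ge r 5 with hr | hr
  · interval_cases r <;> simp [h₂]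
  · exact .inr (.inr (.inr (.inr (.inr ⟨by linarith [h₂_gt r], h₂_strictAnti.antitone hr⟩))))

/-- Here `7/9 * 8/9 < 3/4` makes the tail inert. The factor `8/9` is the correction for a product
with a class `2` or class `1` number of coefficient `1`; it turns `3/4 + 1/(4 * 3^n)` into `2/3 +
2/3^(n+2)`, the source of that family in `h₀` and `h₂`. -/
theorem range_h₁_cases {x : ℚ} (hx : x ∈ Set.range h₁) :
    x = 1 ∨ x = 8 / 9 ∨ x = 5 / 6 ∨ x = 64 / 81 ∨
      (0 < x ∧ x ≤ 7 / 9 ∧ 8 / 9 * x ∈ Set.range h₀ ∧ 8 / 9 * x ∈ Set.range h₂) := by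
  obtain ⟨r, rfl⟩ := hx
  rcases lt_or_ge r 4 with hr | hr
  · interval_cases r <;> simp [h₁]
  refine .inr (.inr (.inr (.inr ⟨by linarith [h₁_gt r], h₁_strictAnti.antitone hr, ?_⟩)))
  rcases lt_or_ge r 6 with hr' | hr'
  · interval_cases r
    · exact ⟨⟨7, by norm_num [h₀, h₁]⟩, ⟨9, by norm_num [h₁, h₂]⟩⟩
    · exact ⟨⟨9, by norm_num [h₀, h₁]⟩, ⟨12, by norm_num [h₁, h₂]⟩⟩
  · obtain ⟨n, rfl⟩ : ∃ n, r = n + 2 := ⟨r - 2, by omega⟩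
    have e : (8 : ℚ) / 9 * (3 / 4 + 1 / (4 * 3 ^ n)) = 2 / 3 + 2 / 3 ^ (n + 2) := by
      rw [pow_add]; field_simp; norm_num
    rw [h₁_large (by omega), e]
    exact ⟨⟨_, h₀_odd (by omega)⟩, ⟨_, h₂_zero (by omega)⟩⟩

theorem mul_mem_range_h₀ {x y : ℚ} (hx : x ∈ Set.range h₀) (hy : y ∈ Set.range h₀)
    (hxy : 2 / 3 < x * y) : x * y ∈ Set.range h₀ := by
  have m1 : (64 / 81 : ℚ) ∈ Set.range h₀ := ⟨2, rfl⟩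
  have m2 : (512 / 729 : ℚ) ∈ Set.range h₀ := ⟨6, rfl⟩
  have m3 : (56 / 81 : ℚ) ∈ Set.range h₀ := ⟨7, rfl⟩
  rcases range_h₀_cases hx with h | h | h | h | ⟨h, h', -⟩ <;>
  rcases range_h₀_cases hy with k | k | k | k | ⟨k, k', -⟩ <;>
  -- The alternatives, in order: a factor `1`; an explicit product found in the table; an explicit
  -- product that is too small; a tail coefficient times a factor below `1`, also too small.
  first
    | (rw [h, one_mul]; exact hy)
    | (rw [k, mul_one]; exact hx)
    | (subst h k; norm_num at hxy ⊢; assumption)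
    | (exfalso; subst h k; norm_num at hxy)
    | (exfalso; nlinarith)

theorem mul_mem_range_h₂ {x y : ℚ} (hx : x ∈ Set.range h₀) (hy : y ∈ Set.range h₂)
    (hxy : 2 / 3 < x * y) : x * y ∈ Set.range h₂ := by
  have m0 : (8 / 9 : ℚ) ∈ Set.range h₂ := ⟨1, rfl⟩
  have m1 : (64 / 81 : ℚ) ∈ Set.range h₂ := ⟨3, rfl⟩
  have m2 : (512 / 729 : ℚ) ∈ Set.range h₂ := ⟨8, rfl⟩
  have m3 : (56 / 81 : ℚ) ∈ Set.range h₂ := ⟨9, rfl⟩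
  have m4 : (20 / 27 : ℚ) ∈ Set.range h₂ := ⟨5, rfl⟩
  have m5 : (7 / 9 : ℚ) ∈ Set.range h₂ := ⟨4, rfl⟩
  rcases range_h₀_cases hx with h | h | h | h | ⟨h, h', h''⟩ <;>
  rcases range_h₂_cases hy with k | k | k | k | k | ⟨k, k'⟩ <;>
  first
    | (rw [h, one_mul]; exact hy)
    | (rw [k, mul_one]; exact h'')
    | (subst h k; norm_num at hxy ⊢; assumption)
    | (exfalso; subst h k; norm_num at hxy)
    | (exfalso; nlinarith)

/-- Since `20/27 < 3/4`, the tail of `h₀` is excluded even against the factor `1`. -/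
theorem mul_mem_range_h₁ {x y : ℚ} (hx : x ∈ Set.range h₀) (hy : y ∈ Set.range h₁)
    (hxy : 3 / 4 < x * y) : x * y ∈ Set.range h₁ := by
  have m0 : (8 / 9 : ℚ) ∈ Set.range h₁ := ⟨1, rfl⟩
  have m1 : (64 / 81 : ℚ) ∈ Set.range h₁ := ⟨3, rfl⟩
  have m5 : (7 / 9 : ℚ) ∈ Set.range h₁ := ⟨4, rfl⟩
  rcases range_h₀_cases hx with h | h | h | h | ⟨h, h', -⟩ <;>
  rcases range_h₁_cases hy with k | k | k | k | ⟨k, k', -, -⟩ <;>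
  first
    | (rw [h, one_mul]; exact hy)
    | (subst h k; norm_num at hxy ⊢; assumption)
    | (exfalso; subst h k; norm_num at hxy)
    | (exfalso; nlinarith)

theorem mul_mem_range_h₁_of_h₂ {x y : ℚ} (hx : x ∈ Set.range h₂) (hy : y ∈ Set.range h₂)
    (hxy : 3 / 4 < x * y) : x * y ∈ Set.range h₁ := by
  have m : (1 : ℚ) ∈ Set.range h₁ := ⟨0, rfl⟩
  have m0 : (8 / 9 : ℚ) ∈ Set.range h₁ := ⟨1, rfl⟩
  have m1 : (64 / 81 : ℚ) ∈ Set.range h₁ := ⟨3, rfl⟩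
  have m4 : (5 / 6 : ℚ) ∈ Set.range h₁ := ⟨2, rfl⟩
  have m5 : (7 / 9 : ℚ) ∈ Set.range h₁ := ⟨4, rfl⟩
  rcases range_h₂_cases hx with h | h | h | h | h | ⟨h, h'⟩ <;>
  rcases range_h₂_cases hy with k | k | k | k | k | ⟨k, k'⟩ <;>
  first
    | (subst h k; norm_num only at hxy ⊢; assumption)
    | (exfalso; subst h k; norm_num at hxy)
    | (exfalso; nlinarith)

/-- The correction `8/9` comes from `2 * 4 = 8` against `9`, and `3/4 < x * y` amounts to `2/3 < 8/9
* (x * y)`. -/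
theorem mul_mem_range_h₀_of_h₂_h₁ {x y : ℚ} (hx : x ∈ Set.range h₂) (hy : y ∈ Set.range h₁)
    (hxy : 3 / 4 < x * y) : 8 / 9 * (x * y) ∈ Set.range h₀ := by
  have m0 : (8 / 9 : ℚ) ∈ Set.range h₀ := ⟨1, rfl⟩
  have m1 : (64 / 81 : ℚ) ∈ Set.range h₀ := ⟨2, rfl⟩
  have m2 : (512 / 729 : ℚ) ∈ Set.range h₀ := ⟨6, rfl⟩
  have m3 : (56 / 81 : ℚ) ∈ Set.range h₀ := ⟨7, rfl⟩
  have m4 : (20 / 27 : ℚ) ∈ Set.range h₀ := ⟨4, rfl⟩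
  rcases range_h₂_cases hx with h | h | h | h | h | ⟨h, h'⟩ <;>
  rcases range_h₁_cases hy with k | k | k | k | ⟨k, k', k'', -⟩ <;>
  first
    | (subst h k; norm_num only at hxy ⊢; assumption)
    | (rw [h, one_mul]; exact k'')
    | (exfalso; subst h k; norm_num at hxy)
    | (exfalso; nlinarith)

theorem mul_mem_range_h₂_of_h₁ {x y : ℚ} (hx : x ∈ Set.range h₁) (hy : y ∈ Set.range h₁)
    (hxy : 3 / 4 < x * y) : 8 / 9 * (x * y) ∈ Set.range h₂ := by
  have m0 : (8 / 9 : ℚ) ∈ Set.range h₂ := ⟨1, rfl⟩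
  have m1 : (64 / 81 : ℚ) ∈ Set.range h₂ := ⟨3, rfl⟩
  have m2 : (512 / 729 : ℚ) ∈ Set.range h₂ := ⟨8, rfl⟩
  have m4 : (20 / 27 : ℚ) ∈ Set.range h₂ := ⟨5, rfl⟩
  rcases range_h₁_cases hx with h | h | h | h | ⟨h, h', -, h''⟩ <;>
  rcases range_h₁_cases hy with k | k | k | k | ⟨k, k', -, k''⟩ <;>
  first
    | (subst h k; norm_num only at hxy ⊢; assumption)
    | (rw [h, one_mul]; exact k'')
    | (rw [k, mul_one]; exact h'')
    | (exfalso; subst h k; norm_num at hxy)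
    | (exfalso; nlinarith)

/-! ### Every number exceeding `E (k - 1)` is given by a coefficient -/

/-- This is the ratio `(2 * 3^m + 1) / 3^(m+1)` of `E (k - 1) + 1` to `E k` for `k = 3 * m + 3`. The
first five values are sporadic table entries; the regular family begins at `m = 5`. -/
theorem succ_maxVal_coeff_mem_range_h₀ (m : ℕ) : (2 / 3 + 1 / 3 ^ (m + 1) : ℚ) ∈ Set.range h₀ := by
  rcases lt_or_ge m 5 with hm | hm
  · interval_cases m
    exacts [⟨0, by norm_num [h₀]⟩, ⟨3, by norm_num [h₀]⟩, ⟨5, by norm_num [h₀]⟩,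
      ⟨8, by norm_num [h₀]⟩, ⟨10, by norm_num [h₀]⟩]
  · exact ⟨_, h₀_even (by omega)⟩

theorem succ_maxVal_coeff_mem_range_h₂ (m : ℕ) :
    (2 / 3 + 1 / (2 * 3 ^ (m + 1)) : ℚ) ∈ Set.range h₂ := by
  rcases lt_or_ge m 4 with hm | hm
  · interval_cases m
    exacts [⟨2, by norm_num [h₂]⟩, ⟨6, by norm_num [h₂]⟩, ⟨10, by norm_num [h₂]⟩,
      ⟨13, by norm_num [h₂]⟩]
  · exact ⟨_, h₂_one (n := m + 2) (by omega)⟩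

theorem succ_maxVal_coeff_mem_range_h₁ (m : ℕ) :
    (3 / 4 + 1 / (4 * 3 ^ m) : ℚ) ∈ Set.range h₁ := by
  rcases lt_or_ge m 4 with hm | hm
  · interval_cases m
    exacts [⟨0, by norm_num [h₁]⟩, ⟨2, by norm_num [h₁]⟩, ⟨4, by norm_num [h₁]⟩,
      ⟨5, by norm_num [h₁]⟩]
  · exact ⟨_, h₁_large hm⟩

/-- The set of coefficients `h_{r,a}` for the residue class `a` of `k`. -/
def coeffs (k : ℕ) : Set ℚ := Set.range fun r => h r (k : ZMod 3)

/-! ### Coefficients and thresholds by residue class -/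

theorem natCast_three_mul_add (m c : ℕ) : ((3 * m + c : ℕ) : ZMod 3) = c := by
  have : (3 : ZMod 3) = 0 := rfl
  push_cast
  rw [this, zero_mul, zero_add]

theorem h_three (r m : ℕ) : h r ((3 * m + 3 : ℕ) : ZMod 3) = h₀ r := by
  rw [natCast_three_mul_add]; rfl

theorem h_two (r m : ℕ) : h r ((3 * m + 2 : ℕ) : ZMod 3) = h₂ r := by
  rw [natCast_three_mul_add]; rfl

theorem h_four (r m : ℕ) : h r ((3 * m + 4 : ℕ) : ZMod 3) = h₁ r := by
  rw [natCast_three_mul_add]; rfl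

theorem K_three (r m : ℕ) : K r ((3 * m + 3 : ℕ) : ZMod 3) = K₀ r := by
  rw [natCast_three_mul_add]; rfl

theorem K_two (r m : ℕ) : K r ((3 * m + 2 : ℕ) : ZMod 3) = K₂ r := by
  rw [natCast_three_mul_add]; rfl

theorem K_four (r m : ℕ) : K r ((3 * m + 4 : ℕ) : ZMod 3) = K₁ r := by
  rw [natCast_three_mul_add]; rfl

theorem coeffs_three (m : ℕ) : coeffs (3 * m + 3) = Set.range h₀ := by
  simp only [coeffs, h_three]

theorem coeffs_two (m : ℕ) : coeffs (3 * m + 2) = Set.range h₂ := by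
  simp only [coeffs, h_two]

theorem coeffs_four (m : ℕ) : coeffs (3 * m + 4) = Set.range h₁ := by
  simp only [coeffs, h_four]

theorem maxVal_pred_three (m : ℕ) :
    (maxVal (3 * m + 3 - 1) : ℚ) = 2 / 3 * maxVal (3 * m + 3) := by
  rw [show 3 * m + 3 - 1 = 3 * m + 2 by omega, maxVal_two, maxVal_three]
  push_cast
  ring

theorem maxVal_pred_two (m : ℕ) :
    (maxVal (3 * (m + 1) + 2 - 1) : ℚ) = 2 / 3 * maxVal (3 * (m + 1) + 2) := by
  rw [show 3 * (m + 1) + 2 - 1 = 3 * m + 4 by omega, maxVal_two, maxVal_four]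
  push_cast
  ring

theorem maxVal_pred_four (m : ℕ) :
    (maxVal (3 * m + 4 - 1) : ℚ) = 3 / 4 * maxVal (3 * m + 4) := by
  rw [show 3 * m + 4 - 1 = 3 * m + 3 by omega, maxVal_four, maxVal_three]
  push_cast
  ring

theorem succ_maxVal_eq_coeff_mul {k : ℕ} (hk : 2 ≤ k) :
    ∃ x ∈ coeffs k, ((maxVal (k - 1) + 1 : ℕ) : ℚ) = x * maxVal k := by
  rcases two_le_cases hk with ⟨m, rfl⟩ | ⟨m, rfl⟩ | ⟨m, rfl⟩
  · refine ⟨_, coeffs_three m ▸ succ_maxVal_coeff_mem_range_h₀ m, ?_⟩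
    rw [Nat.cast_succ, maxVal_pred_three, maxVal_three, pow_succ]
    push_cast
    field_simp
  -- For `k = 2` the ratio `E 1 / E 2` is `1/2` rather than `2/3`, so this case is separate.
  · rcases m with _ | m
    · exact ⟨1, coeffs_two 0 ▸ ⟨0, rfl⟩, by norm_num [maxVal]⟩
    · refine ⟨_, coeffs_two (m + 1) ▸ succ_maxVal_coeff_mem_range_h₂ m, ?_⟩
      rw [Nat.cast_succ, maxVal_pred_two, maxVal_two]
      push_cast
      field_simp
  · refine ⟨_, coeffs_four m ▸ succ_maxVal_coeff_mem_range_h₁ m, ?_⟩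
    rw [Nat.cast_succ, maxVal_pred_four, maxVal_four]
    push_cast
    field_simp

theorem mul_eq_coeff_mul {i j : ℕ} (hi : 2 ≤ i) (hj : 2 ≤ j) {x y : ℚ} (hx : x ∈ coeffs i)
    (hy : y ∈ coeffs j)
    (hlt : (maxVal (i + j - 1) : ℚ) < x * maxVal i * (y * maxVal j)) :
    ∃ z ∈ coeffs (i + j), x * maxVal i * (y * maxVal j) = z * maxVal (i + j) := by
  have coeff_lt : ∀ {c z t : ℚ} {k : ℕ}, (maxVal (k - 1) : ℚ) = c * maxVal k → 2 ≤ k →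
      (maxVal (k - 1) : ℚ) < t → t = z * maxVal k → c < z := by
    intro c z t k h1 hk h2 h3
    rw [h1, h3] at h2
    exact lt_of_mul_lt_mul_right h2 (Nat.cast_nonneg _)
  -- Reduces each pair of residues to the ratio `c` of consecutive maxima, the corrected coefficient
  -- `z`, and a closure lemma valid above `c`.
  have goal_of : ∀ {k : ℕ} {c z : ℚ}, i + j = k → (maxVal (k - 1) : ℚ) = c * maxVal k →
      x * maxVal i * (y * maxVal j) = z * maxVal k → (c < z → z ∈ coeffs k) →
      ∃ z ∈ coeffs (i + j), x * maxVal i * (y * maxVal j) = z * maxVal (i + j) := by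
    rintro k c z rfl h1 h2 h3
    exact ⟨z, h3 (coeff_lt h1 (by omega) hlt h2), h2⟩
  rcases two_le_cases hi with ⟨m, rfl⟩ | ⟨m, rfl⟩ | ⟨m, rfl⟩ <;>
  rcases two_le_cases hj with ⟨l, rfl⟩ | ⟨l, rfl⟩ | ⟨l, rfl⟩ <;>
  simp only [coeffs_three, coeffs_two, coeffs_four] at hx hy
  · refine goal_of (k := 3 * (m + l + 1) + 3) (z := x * y) (by ring) (maxVal_pred_three _) ?_ ?_
    · simp only [maxVal_three, pow_add]; push_cast; ring
    · rw [coeffs_three]; exact mul_mem_range_h₀ hx hy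
  · refine goal_of (k := 3 * (m + l + 1) + 2) (z := x * y) (by ring) (maxVal_pred_two _) ?_ ?_
    · simp only [maxVal_three, maxVal_two, pow_add]; push_cast; ring
    · rw [coeffs_two]; exact mul_mem_range_h₂ hx hy
  · refine goal_of (k := 3 * (m + l + 1) + 4) (z := x * y) (by ring) (maxVal_pred_four _) ?_ ?_
    · simp only [maxVal_three, maxVal_four, pow_add]; push_cast; ring
    · rw [coeffs_four]; exact mul_mem_range_h₁ hx hy
  · refine goal_of (k := 3 * (m + l + 1) + 2) (z := y * x) (by ring) (maxVal_pred_two _) ?_ ?_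
    · simp only [maxVal_three, maxVal_two, pow_add]; push_cast; ring
    · rw [coeffs_two]; exact mul_mem_range_h₂ hy hx
  · refine goal_of (k := 3 * (m + l) + 4) (z := x * y) (by ring) (maxVal_pred_four _) ?_ ?_
    · simp only [maxVal_two, maxVal_four, pow_add]; push_cast; ring
    · rw [coeffs_four]; exact mul_mem_range_h₁_of_h₂ hx hy
  · refine goal_of (k := 3 * (m + l + 1) + 3) (z := 8 / 9 * (x * y)) (by ring)
      (maxVal_pred_three _) ?_ ?_
    · simp only [maxVal_two, maxVal_three, maxVal_four, pow_add]; push_cast; ring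
    · rw [coeffs_three]; exact fun h => mul_mem_range_h₀_of_h₂_h₁ hx hy (by linarith)
  · refine goal_of (k := 3 * (m + l + 1) + 4) (z := y * x) (by ring) (maxVal_pred_four _) ?_ ?_
    · simp only [maxVal_three, maxVal_four, pow_add]; push_cast; ring
    · rw [coeffs_four]; exact mul_mem_range_h₁ hy hx
  · refine goal_of (k := 3 * (m + l + 1) + 3) (z := 8 / 9 * (y * x)) (by ring)
      (maxVal_pred_three _) ?_ ?_
    · simp only [maxVal_two, maxVal_three, maxVal_four, pow_add]; push_cast; ring
    · rw [coeffs_three]; exact fun h => mul_mem_range_h₀_of_h₂_h₁ hy hx (by linarith)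
  · refine goal_of (k := 3 * (m + l + 1 + 1) + 2) (z := 8 / 9 * (x * y)) (by ring)
      (maxVal_pred_two _) ?_ ?_
    · simp only [maxVal_two, maxVal_four, pow_add]; push_cast; ring
    · rw [coeffs_two]; exact fun h => mul_mem_range_h₂_of_h₁ hx hy (by linarith)

/-- Both factors of a product use at least two ones, hence fewer than `k`, so strong induction
applies to each; the lower bound on the product discards everything outside the tables. -/
theorem eq_coeff_mul_of_mem_topSet {n k : ℕ} (hn : n ∈ topSet k) (hk : 2 ≤ k) :
    ∃ x ∈ coeffs k, (n : ℚ) = x * maxVal k := by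
  induction k using Nat.strong_induction_on generalizing n with
  | _ k ih =>
    rcases topSet_cases hn hk with rfl | ⟨i, j, a, b, hi, hj, rfl, ha, hb, rfl⟩
    · exact succ_maxVal_eq_coeff_mul hk
    · obtain ⟨x, hx, hax⟩ := ih i (by omega) ha hi
      obtain ⟨y, hy, hby⟩ := ih j (by omega) hb hj
      have hlt : ((maxVal (i + j - 1) : ℕ) : ℚ) < (a * b : ℕ) := Nat.cast_lt.2 hn.2
      rw [Nat.cast_mul, hax, hby] at hlt
      rw [Nat.cast_mul, hax, hby]
      exact mul_eq_coeff_mul hi hj hx hy hlt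

/-! ### The coefficients are attained from the thresholds on -/

theorem maxVal_add_one_mem_cpxLE {k : ℕ} (hk : 1 ≤ k) : maxVal k + 1 ∈ cpxLE (k + 1) :=
  add_mem_cpxLE (maxVal_mem_cpxLE hk) one_mem_cpxLE

theorem four_mem_cpxLE : 4 ∈ cpxLE 4 := mul_mem_cpxLE two_mem_cpxLE two_mem_cpxLE

theorem six_mem_cpxLE : 6 ∈ cpxLE 5 := mul_mem_cpxLE two_mem_cpxLE three_mem_cpxLE

theorem eight_mem_cpxLE : 8 ∈ cpxLE 6 := mul_mem_cpxLE four_mem_cpxLE two_mem_cpxLE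

theorem nine_mem_cpxLE : 9 ∈ cpxLE 6 := mul_mem_cpxLE three_mem_cpxLE three_mem_cpxLE

theorem fifteen_mem_cpxLE : 15 ∈ cpxLE 8 :=
  mul_mem_cpxLE three_mem_cpxLE (maxVal_add_one_mem_cpxLE (k := 4) (by norm_num))

theorem sixty_three_mem_cpxLE : 63 ∈ cpxLE 12 :=
  mul_mem_cpxLE nine_mem_cpxLE (maxVal_add_one_mem_cpxLE (k := 5) (by norm_num))

theorem nineteen_mem_cpxLE : 19 ∈ cpxLE 9 := maxVal_add_one_mem_cpxLE (k := 8) (by norm_num)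

theorem eighty_two_mem_cpxLE : 82 ∈ cpxLE 13 := maxVal_add_one_mem_cpxLE (k := 12) (by norm_num)

theorem nine_mul_fifty_five_mem_cpxLE : 495 ∈ cpxLE 18 :=
  mul_mem_cpxLE nine_mem_cpxLE (maxVal_add_one_mem_cpxLE (k := 11) (by norm_num))

theorem three_mul_one_hundred_sixty_three_mem_cpxLE : 489 ∈ cpxLE 18 :=
  mul_mem_cpxLE three_mem_cpxLE (maxVal_add_one_mem_cpxLE (k := 14) (by norm_num))

/-! ### Closed forms and monotonicity of the thresholds -/

theorem K₀_odd {n : ℕ} (hn : 6 ≤ n) : K₀ (2 * n - 1) = 3 * n := by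
  obtain ⟨n, rfl⟩ := Nat.exists_eq_add_of_le' hn
  rw [show 2 * (n + 6) - 1 = 2 * n + 11 by omega]
  simp only [K₀]
  omega

theorem K₀_even {n : ℕ} (hn : 6 ≤ n) : K₀ (2 * n) = 3 * n := by
  obtain ⟨n, rfl⟩ := Nat.exists_eq_add_of_le' hn
  rw [show 2 * (n + 6) = 2 * n + 1 + 11 by omega]
  simp only [K₀]
  omega

theorem K₂_large {r : ℕ} (hr : 15 ≤ r) : K₂ r = 3 * (r / 3 + 1) + 2 := by
  obtain ⟨n, rfl⟩ := Nat.exists_eq_add_of_le' hr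
  rfl

theorem K₁_large {n : ℕ} (hn : 4 ≤ n) : K₁ (n + 2) = 3 * n + 4 := by
  obtain ⟨n, rfl⟩ := Nat.exists_eq_add_of_le' hn
  rfl

theorem K₀_monotone : Monotone K₀ := by
  refine monotone_nat_of_le_succ fun r => ?_
  rcases lt_or_ge r 11 with hr | hr
  · interval_cases r <;> norm_num [K₀]
  · obtain ⟨n, hn, rfl | rfl⟩ := eleven_le_cases hr
    · rw [show 2 * n - 1 + 1 = 2 * n by omega, K₀_odd hn, K₀_even hn]
    · rw [show 2 * n + 1 = 2 * (n + 1) - 1 by omega, K₀_odd (by omega), K₀_even hn]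
      omega

theorem K₂_monotone : Monotone K₂ := by
  refine monotone_nat_of_le_succ fun r => ?_
  rcases lt_or_ge r 15 with hr | hr
  · interval_cases r <;> norm_num [K₂]
  · rw [K₂_large hr, K₂_large (by omega)]
    omega

theorem K₁_monotone : Monotone K₁ := by
  refine monotone_nat_of_le_succ fun r => ?_
  rcases lt_or_ge r 6 with hr | hr
  · interval_cases r <;> norm_num [K₁]
  · obtain ⟨n, rfl⟩ : ∃ n, r = n + 2 := ⟨r - 2, by omega⟩
    rw [show n + 2 + 1 = n + 1 + 2 by ring, K₁_large (by omega), K₁_large (by omega)]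
    omega

/-! ### Numbers realising the coefficients at the thresholds -/

theorem exists_h₀ (r : ℕ) : ∃ c ∈ cpxLE (K₀ r), (c : ℚ) = h₀ r * maxVal (K₀ r) := by
  rcases lt_or_ge r 11 with hr | hr
  · have e64 : 64 ∈ cpxLE 12 := mul_mem_cpxLE eight_mem_cpxLE eight_mem_cpxLE
    interval_cases r
    · exact ⟨3, three_mem_cpxLE, by norm_num [h₀, K₀, maxVal]⟩
    · exact ⟨8, eight_mem_cpxLE, by norm_num [h₀, K₀, maxVal]⟩
    · exact ⟨64, e64, by norm_num [h₀, K₀, maxVal]⟩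
    · exact ⟨63, sixty_three_mem_cpxLE, by norm_num [h₀, K₀, maxVal]⟩
    · exact ⟨60, mul_mem_cpxLE four_mem_cpxLE fifteen_mem_cpxLE,
        by norm_num [h₀, K₀, maxVal]⟩
    · exact ⟨57, mul_mem_cpxLE three_mem_cpxLE nineteen_mem_cpxLE,
        by norm_num [h₀, K₀, maxVal]⟩
    · exact ⟨512, mul_mem_cpxLE eight_mem_cpxLE e64, by norm_num [h₀, K₀, maxVal]⟩
    · exact ⟨504, mul_mem_cpxLE eight_mem_cpxLE sixty_three_mem_cpxLE,
        by norm_num [h₀, K₀, maxVal]⟩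
    · exact ⟨495, nine_mul_fifty_five_mem_cpxLE, by norm_num [h₀, K₀, maxVal]⟩
    · exact ⟨492, mul_mem_cpxLE six_mem_cpxLE eighty_two_mem_cpxLE,
        by norm_num [h₀, K₀, maxVal]⟩
    · exact ⟨489, three_mul_one_hundred_sixty_three_mem_cpxLE,
        by norm_num [h₀, K₀, maxVal]⟩
  · obtain ⟨n, hn, hr⟩ := eleven_le_cases hr
    obtain ⟨n, rfl⟩ := Nat.exists_eq_add_of_le' (show 1 ≤ n by omega)
    obtain ⟨l, rfl⟩ := Nat.exists_eq_add_of_le' (show 1 ≤ n by omega)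
    rcases hr with rfl | rfl
    · rw [h₀_odd hn, K₀_odd hn]
      -- The witness is `2 * (3^(l+1) + 1)`; the even case below uses `E (k - 1) + 1` itself.
      have := mul_mem_cpxLE two_mem_cpxLE
        (maxVal_add_one_mem_cpxLE (k := 3 * l + 3) (by omega))
      rw [show 2 + (3 * l + 3 + 1) = 3 * (l + 1) + 3 by ring] at this
      refine ⟨_, this, ?_⟩
      rw [show 3 * (l + 1 + 1) = 3 * (l + 1) + 3 by ring, maxVal_three, maxVal_three]
      push_cast
      simp only [pow_succ]
      field_simp
    · rw [h₀_even hn, K₀_even hn]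
      refine ⟨_, maxVal_add_one_mem_cpxLE (k := 3 * (l + 1) + 2) (by omega), ?_⟩
      rw [show 3 * (l + 1 + 1) = 3 * (l + 1) + 3 by ring, maxVal_three, maxVal_two]
      push_cast
      simp only [pow_succ]
      field_simp

theorem exists_h₂ (r : ℕ) : ∃ c ∈ cpxLE (K₂ r), (c : ℚ) = h₂ r * maxVal (K₂ r) := by
  rcases lt_or_ge r 15 with hr | hr
  · have e16 : 16 ∈ cpxLE 8 := mul_mem_cpxLE eight_mem_cpxLE two_mem_cpxLE
    interval_cases r
    · exact ⟨2, two_mem_cpxLE, by norm_num [h₂, K₂, maxVal]⟩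
    · exact ⟨16, e16, by norm_num [h₂, K₂, maxVal]⟩
    · exact ⟨15, fifteen_mem_cpxLE, by norm_num [h₂, K₂, maxVal]⟩
    · exact ⟨128, mul_mem_cpxLE e16 eight_mem_cpxLE, by norm_num [h₂, K₂, maxVal]⟩
    · exact ⟨126, mul_mem_cpxLE two_mem_cpxLE sixty_three_mem_cpxLE,
        by norm_num [h₂, K₂, maxVal]⟩
    · exact ⟨120, mul_mem_cpxLE eight_mem_cpxLE fifteen_mem_cpxLE,
        by norm_num [h₂, K₂, maxVal]⟩
    · exact ⟨117, mul_mem_cpxLE nine_mem_cpxLE (maxVal_add_one_mem_cpxLE (k := 7) (by norm_num)),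
        by norm_num [h₂, K₂, maxVal]⟩
    · exact ⟨114, mul_mem_cpxLE six_mem_cpxLE nineteen_mem_cpxLE,
        by norm_num [h₂, K₂, maxVal]⟩
    · exact ⟨1024, mul_mem_cpxLE (mul_mem_cpxLE e16 e16) four_mem_cpxLE,
        by norm_num [h₂, K₂, maxVal]⟩
    · exact ⟨1008, mul_mem_cpxLE e16 sixty_three_mem_cpxLE, by norm_num [h₂, K₂, maxVal]⟩
    · exact ⟨999, mul_mem_cpxLE (mul_mem_cpxLE nine_mem_cpxLE three_mem_cpxLE)
        (maxVal_add_one_mem_cpxLE (k := 10) (by norm_num)), by norm_num [h₂, K₂, maxVal]⟩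
    · exact ⟨990, mul_mem_cpxLE two_mem_cpxLE nine_mul_fifty_five_mem_cpxLE,
        by norm_num [h₂, K₂, maxVal]⟩
    · exact ⟨984, mul_mem_cpxLE (mul_mem_cpxLE two_mem_cpxLE six_mem_cpxLE) eighty_two_mem_cpxLE,
        by norm_num [h₂, K₂, maxVal]⟩
    · exact ⟨981, mul_mem_cpxLE nine_mem_cpxLE (maxVal_add_one_mem_cpxLE (k := 13) (by norm_num)),
        by norm_num [h₂, K₂, maxVal]⟩
    · exact ⟨978, mul_mem_cpxLE two_mem_cpxLE three_mul_one_hundred_sixty_three_mem_cpxLE,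
        by norm_num [h₂, K₂, maxVal]⟩
  · obtain ⟨n, hn, hr'⟩ := fifteen_le_cases hr
    rw [K₂_large hr, show r / 3 + 1 = n by omega]
    obtain ⟨n, rfl⟩ := Nat.exists_eq_add_of_le' (show 1 ≤ n by omega)
    obtain ⟨l, rfl⟩ := Nat.exists_eq_add_of_le' (show 1 ≤ n by omega)
    rw [maxVal_two]
    rcases hr' with rfl | rfl | rfl
    · have := mul_mem_cpxLE four_mem_cpxLE
        (maxVal_add_one_mem_cpxLE (k := 3 * l + 3) (by omega))
      rw [show 4 + (3 * l + 3 + 1) = 3 * (l + 1 + 1) + 2 by ring] at this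
      refine ⟨_, this, ?_⟩
      rw [h₂_zero hn, maxVal_three]
      push_cast
      simp only [pow_succ]
      field_simp
      ring
    -- The number `4 * 3^l + 1` already has this coefficient three ones earlier; the factor `3`
    -- lifts it to the threshold shared by its block.
    · have := mul_mem_cpxLE three_mem_cpxLE
        (maxVal_add_one_mem_cpxLE (k := 3 * l + 4) (by omega))
      rw [show 3 + (3 * l + 4 + 1) = 3 * (l + 1 + 1) + 2 by ring] at this
      refine ⟨_, this, ?_⟩
      rw [h₂_one hn, maxVal_four, Nat.add_sub_cancel]
      push_cast
      simp only [pow_succ]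
      field_simp
      ring
    · have := mul_mem_cpxLE two_mem_cpxLE
        (maxVal_add_one_mem_cpxLE (k := 3 * (l + 1) + 2) (by omega))
      rw [show 2 + (3 * (l + 1) + 2 + 1) = 3 * (l + 1 + 1) + 2 by ring] at this
      refine ⟨_, this, ?_⟩
      rw [h₂_two hn, maxVal_two]
      push_cast
      simp only [pow_succ]
      field_simp

theorem exists_h₁ (r : ℕ) : ∃ c ∈ cpxLE (K₁ r), (c : ℚ) = h₁ r * maxVal (K₁ r) := by
  rcases lt_or_ge r 6 with hr | hr
  · interval_cases r
    · exact ⟨4, four_mem_cpxLE, by norm_num [h₁, K₁, maxVal]⟩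
    · exact ⟨32, mul_mem_cpxLE eight_mem_cpxLE four_mem_cpxLE, by norm_num [h₁, K₁, maxVal]⟩
    · exact ⟨30, mul_mem_cpxLE two_mem_cpxLE fifteen_mem_cpxLE, by norm_num [h₁, K₁, maxVal]⟩
    · exact ⟨256, mul_mem_cpxLE (mul_mem_cpxLE eight_mem_cpxLE eight_mem_cpxLE) four_mem_cpxLE,
        by norm_num [h₁, K₁, maxVal]⟩
    · exact ⟨252, mul_mem_cpxLE four_mem_cpxLE sixty_three_mem_cpxLE,
        by norm_num [h₁, K₁, maxVal]⟩
    · exact ⟨246, mul_mem_cpxLE three_mem_cpxLE eighty_two_mem_cpxLE,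
        by norm_num [h₁, K₁, maxVal]⟩
  · obtain ⟨n, rfl⟩ : ∃ n, r = n + 2 := ⟨r - 2, by omega⟩
    rw [h₁_large (by omega), K₁_large (by omega)]
    refine ⟨_, maxVal_add_one_mem_cpxLE (k := 3 * n + 3) (by omega), ?_⟩
    rw [maxVal_three, maxVal_four]
    push_cast
    field_simp

/-- Multiplying by `3` costs three ones and scales the maximum by exactly `3`. This needs `k ≥ 2`,
as `maxVal 4` is not `3 * maxVal 1`. -/
theorem exists_add_three_mul {x : ℚ} {k : ℕ} (hk : 2 ≤ k)
    (hx : ∃ c ∈ cpxLE k, (c : ℚ) = x * maxVal k) (j : ℕ) :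
    ∃ c ∈ cpxLE (k + 3 * j), (c : ℚ) = x * maxVal (k + 3 * j) := by
  obtain ⟨c, hc, hcx⟩ := hx
  refine ⟨_, mul_three_pow_mem_cpxLE hc j, ?_⟩
  rw [maxVal_add_three_mul hk]
  push_cast
  rw [hcx, mul_assoc]

theorem K₀_mod (r : ℕ) : K₀ r % 3 = 0 := by
  rcases lt_or_ge r 11 with hr | hr
  · interval_cases r <;> rfl
  · obtain ⟨n, hn, rfl | rfl⟩ := eleven_le_cases hr
    · rw [K₀_odd hn]; omega
    · rw [K₀_even hn]; omega

theorem K₂_mod (r : ℕ) : K₂ r % 3 = 2 := by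
  rcases lt_or_ge r 15 with hr | hr
  · interval_cases r <;> rfl
  · rw [K₂_large hr]; omega

theorem K₁_mod (r : ℕ) : K₁ r % 3 = 1 := by
  rcases lt_or_ge r 6 with hr | hr
  · interval_cases r <;> rfl
  · obtain ⟨n, rfl⟩ : ∃ n, r = n + 2 := ⟨r - 2, by omega⟩
    rw [K₁_large (by omega)]; omega

theorem one_lt_K (r : ℕ) (a : ZMod 3) : 1 < K r a := by
  have h0 : 3 ≤ K₀ r := K₀_monotone (Nat.zero_le r)
  have h1 : 4 ≤ K₁ r := K₁_monotone (Nat.zero_le r)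
  have h2 : 2 ≤ K₂ r := K₂_monotone (Nat.zero_le r)
  unfold K
  split_ifs <;> omega

/-- Ensures that once the `r`-th coefficient is attained, so are all earlier ones; otherwise the
rank would be wrong. -/
theorem K_monotone (a : ZMod 3) : Monotone fun r => K r a := by
  intro r s hrs
  have h0 := K₀_monotone hrs
  have h1 := K₁_monotone hrs
  have h2 := K₂_monotone hrs
  unfold K
  split_ifs <;> assumption

theorem h_strictAnti (a : ZMod 3) : StrictAnti fun r => h r a := by
  intro r s hrs
  have h0 := h₀_strictAnti hrs
  have h1 := h₁_strictAnti hrs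
  have h2 := h₂_strictAnti hrs
  unfold h
  split_ifs <;> assumption

theorem exists_h {r k : ℕ} (hk : K r (k : ZMod 3) ≤ k) :
    ∃ c ∈ cpxLE k, (c : ℚ) = h r (k : ZMod 3) * maxVal k := by
  have h2 := (one_lt_K r k).trans_le hk
  have h3 := one_lt_K r k
  rcases two_le_cases h2 with ⟨m, rfl⟩ | ⟨m, rfl⟩ | ⟨m, rfl⟩
  · rw [K_three] at hk h3
    rw [h_three]
    have := K₀_mod r
    obtain ⟨j, hj⟩ : ∃ j, 3 * m + 3 = K₀ r + 3 * j := ⟨(3 * m + 3 - K₀ r) / 3, by omega⟩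
    rw [hj]
    exact exists_add_three_mul h3 (exists_h₀ r) j
  · rw [K_two] at hk h3
    rw [h_two]
    have := K₂_mod r
    obtain ⟨j, hj⟩ : ∃ j, 3 * m + 2 = K₂ r + 3 * j := ⟨(3 * m + 2 - K₂ r) / 3, by omega⟩
    rw [hj]
    exact exists_add_three_mul h3 (exists_h₂ r) j
  · rw [K_four] at hk h3
    rw [h_four]
    have := K₁_mod r
    obtain ⟨j, hj⟩ : ∃ j, 3 * m + 4 = K₁ r + 3 * j := ⟨(3 * m + 4 - K₁ r) / 3, by omega⟩
    rw [hj]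
    exact exists_add_three_mul h3 (exists_h₁ r) j

theorem maxVal_pred_lt {k : ℕ} (hk : 2 ≤ k) (r : ℕ) :
    (maxVal (k - 1) : ℚ) < h r (k : ZMod 3) * maxVal k := by
  have hpos : (0 : ℚ) < maxVal k := Nat.cast_pos.2 (maxVal_pos (by omega))
  rcases two_le_cases hk with ⟨m, rfl⟩ | ⟨m, rfl⟩ | ⟨m, rfl⟩
  · rw [h_three, maxVal_pred_three]
    exact mul_lt_mul_of_pos_right (h₀_gt r) hpos
  · rw [h_two]
    rcases m with _ | m
    · have := h₂_gt r
      norm_num [maxVal]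
      linarith
    · rw [maxVal_pred_two]
      exact mul_lt_mul_of_pos_right (h₂_gt r) hpos
  · rw [h_four, maxVal_pred_four]
    exact mul_lt_mul_of_pos_right (h₁_gt r) hpos

/-! ### Counting -/

theorem isRthLargest_of_enumeration {S : Set ℕ} {f : ℕ → ℕ} {r : ℕ} (hmem : ∀ i ≤ r, f i ∈ S)
    (hanti : ∀ i j, i < j → j ≤ r → f j < f i) (hsurj : ∀ m ∈ S, f r < m → ∃ i < r, m = f i) :
    IsRthLargest S r (f r) := by
  refine ⟨hmem r le_rfl, ?_⟩
  have himage : {m ∈ S | f r < m} = f '' (Finset.range r : Set ℕ) := by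
    ext m
    constructor
    · rintro ⟨hm, hlt⟩
      obtain ⟨i, hi, rfl⟩ := hsurj m hm hlt
      exact ⟨i, by simpa using hi, rfl⟩
    · rintro ⟨i, hi, rfl⟩
      have hi : i < r := by simpa using hi
      exact ⟨hmem i hi.le, hanti i r hi le_rfl⟩
  have hinj : Set.InjOn f (Finset.range r : Set ℕ) := by
    intro i hi j hj hij
    have hi : i < r := by simpa using hi
    have hj : j < r := by simpa using hj
    rcases lt_trichotomy i j with h | h | h
    · exact absurd hij (hanti i j h hj.le).ne'
    · exact h
    · exact absurd hij (hanti j i h hi.le).ne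
  rw [himage, hinj.encard_image, Set.encard_coe_eq_coe_finsetCard, Finset.card_range]

theorem cpx_eq_of_mem_topSet {n k : ℕ} (hn : n ∈ topSet k) : cpx n = k := by
  refine le_antisymm hn.1.2 (le_of_not_gt fun h => ?_)
  exact hn.2.not_ge (le_maxVal_of_mem_cpxLE ⟨hn.1.1, Nat.le_sub_one_of_lt h⟩)

theorem exists_isRthLargest {r k : ℕ} (hk : K r (k : ZMod 3) ≤ k) :
    ∃ n ∈ topSet k, (n : ℚ) = h r (k : ZMod 3) * maxVal k ∧
      IsRthLargest (cpxLE k) r n ∧ IsRthLargest (cpxEq k) r n := by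
  have hk2 : 2 ≤ k := (one_lt_K r k).trans_le hk
  have hpos : (0 : ℚ) < maxVal k := Nat.cast_pos.2 (maxVal_pos (by omega))
  have hex : ∀ i, ∃ n, i ≤ r → n ∈ topSet k ∧ (n : ℚ) = h i (k : ZMod 3) * maxVal k := by
    intro i
    by_cases hi : i ≤ r
    · obtain ⟨n, hn, hnq⟩ := exists_h ((K_monotone (k : ZMod 3) hi).trans hk)
      refine ⟨n, fun _ => ⟨⟨hn, ?_⟩, hnq⟩⟩
      have := maxVal_pred_lt hk2 i
      rw [← hnq] at this
      exact_mod_cast this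
    -- Indices above `r` get an arbitrary value, so that `f` is total.
    · exact ⟨0, fun h => absurd h hi⟩
  choose f hf using hex
  have hanti : ∀ i j, i < j → j ≤ r → f j < f i := by
    intro i j hij hj
    have : (f j : ℚ) < f i := by
      rw [(hf j hj).2, (hf i (hij.le.trans hj)).2]
      exact mul_lt_mul_of_pos_right (h_strictAnti _ hij) hpos
    exact_mod_cast this
  have hsurj : ∀ m ∈ cpxLE k, f r < m → ∃ i < r, m = f i := by
    intro m hm hlt
    -- Anything above `f r` also exceeds `maxVal (k - 1)`, so it lies in `topSet k` and has some
    -- coefficient `h i`; strict monotonicity then forces `i < r`.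
    obtain ⟨x, ⟨i, rfl⟩, hmi⟩ :=
      eq_coeff_mul_of_mem_topSet (k := k) ⟨hm, (hf r le_rfl).1.2.trans hlt⟩ hk2
    have hlt' : (f r : ℚ) < m := Nat.cast_lt.2 hlt
    rw [(hf r le_rfl).2, hmi] at hlt'
    have hir : i < r := (h_strictAnti (k : ZMod 3)).lt_iff_gt.1
      (lt_of_mul_lt_mul_right hlt' hpos.le)
    refine ⟨i, hir, ?_⟩
    have : (m : ℚ) = f i := by rw [hmi, (hf i hir.le).2]
    exact_mod_cast this
  refine ⟨f r, (hf r le_rfl).1, (hf r le_rfl).2,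
    isRthLargest_of_enumeration (fun i hi => (hf i hi).1.1) hanti hsurj,
    isRthLargest_of_enumeration
      (fun i hi => ⟨(hf i hi).1.1.1, cpx_eq_of_mem_topSet (hf i hi).1⟩) hanti
      (fun m hm => hsurj m ⟨hm.1, hm.2.le⟩)⟩

end IntegerComplexity

theorem mainTheorem5 (r : ℕ) (a : ZMod 3) :
    1 < IntegerComplexity.K r a ∧
    ∀ k : ℕ, IntegerComplexity.K r a ≤ k → (k : ZMod 3) = a →
      IntegerComplexity.IsRthLargest (IntegerComplexity.cpxLE k) r (IntegerComplexity.Er r k) ∧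
      (IntegerComplexity.Er r k : ℚ) = IntegerComplexity.h r a * (IntegerComplexity.E k : ℚ) ∧
      IntegerComplexity.E (k - 1) < IntegerComplexity.Er r k ∧
      IntegerComplexity.cpx (IntegerComplexity.Er r k) = k ∧
      IntegerComplexity.IsRthLargest (IntegerComplexity.cpxEq k) r (IntegerComplexity.Er r k) := by
  refine ⟨IntegerComplexity.one_lt_K r a, ?_⟩
  rintro k hk rfl
  have hk2 : 2 ≤ k := (IntegerComplexity.one_lt_K r k).trans_le hk
  obtain ⟨n, hn, hnq, hle, heq⟩ := IntegerComplexity.exists_isRthLargest hk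
  rw [hle.Er_eq, IntegerComplexity.E_eq_maxVal (by omega), IntegerComplexity.E_eq_maxVal (by omega)]
  exact ⟨hle, hnq, hn.2, IntegerComplexity.cpx_eq_of_mem_topSet hn, heq⟩
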